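/- For a ring $R$ and an integer $n\ge 1$, let $MC_n(R)$ (the $n$-matricial closure of $R$) denote the direct limit of the rings $M_{n^k}(R)$, $k=0,1,2,\dots$, where for $m\le k$ the connecting homomorphism $M_{n^m}(R)\to M_{n^k}(R)$ sends $A$ to the block diagonal matrix $\mathrm{diag}(A,\dots,A)$ with $n^{k-m}$ blocks. A ring $R$ is von Neumann regular if for every $a\in R$ there is $x\in R$ with $a=axa$, and it is a left V-ring if every simple left $R$-module is injective. Let $K$ be a field and $n\ge 1$; regard $MC_n(K)$ as a $K$-algebra through the canonical map $K=M_{n^0}(K)\to MC_n(K)$. Then $MC_n(K)$ is von Neumann regular, its center is $K$, and its dimension over $K$ is at most $\aleph_0$. If moreover $n\ge 2$, then $\dim_K MC_n(K)=\aleph_0$, there is a simple left $MC_n(K)$-module that is not injective (indeed no simple left $MC_n(K)$-module is injective), and hence $MC_n(K)$ is not a left V-ring. -/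

import Mathlib

universe u

/-- A ring is von Neumann regular if every element `a` has a quasi-inverse `x`: `a = a * x * a`. -/
def IsVonNeumannRegularRing (R : Type u) [Ring R] : Prop :=
  ∀ a : R, ∃ x : R, a = a * x * a

/-- A ring is a left V-ring if all its simple left modules are injective. (Every simple left
module is isomorphic to a quotient of `R`, so modules in the universe of `R` suffice.) -/
def IsLeftVRing (R : Type u) [Ring R] : Prop :=
  ∀ (S : Type u) [AddCommGroup S] [Module R S], IsSimpleModule R S → Module.Injective R S

namespace MatricialClosure

variable (n : ℕ) (R : Type u) [Ring R]

/-- Splitting an index in `{0, …, n ^ k - 1}` as `i = r + n ^ m * q`, with remainder `r < n ^ m`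
and quotient `q < n ^ (k - m)`. -/
def splitIndex {m k : ℕ} (h : m ≤ k) : Fin (n ^ m) × Fin (n ^ (k - m)) ≃ Fin (n ^ k) :=
  ((Equiv.prodComm _ _).trans finProdFinEquiv).trans
    (finCongr (by rw [← pow_add, Nat.sub_add_cancel h]))

/-- The connecting map `M_{n ^ m}(R) → M_{n ^ k}(R)` for `m ≤ k`: it sends `A` to the block
diagonal matrix with `n ^ (k - m)` diagonal blocks, all equal to `A`. -/
def transition (m k : ℕ) (h : m ≤ k) :
    Matrix (Fin (n ^ m)) (Fin (n ^ m)) R →+* Matrix (Fin (n ^ k)) (Fin (n ^ k)) R :=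
  ((Matrix.reindexRingEquiv R (splitIndex n h)).toRingHom.comp
    (Matrix.blockDiagonalRingHom (Fin (n ^ m)) (Fin (n ^ (k - m))) R)).comp
    (Pi.constRingHom (Fin (n ^ (k - m))) (Matrix (Fin (n ^ m)) (Fin (n ^ m)) R))

theorem splitIndex_val {m k : ℕ} (h : m ≤ k) (p : Fin (n ^ m) × Fin (n ^ (k - m))) :
    (splitIndex n h p : ℕ) = p.1 + n ^ m * p.2 := by
  simp [splitIndex, finProdFinEquiv]

theorem splitIndex_symm_fst {m k : ℕ} (h : m ≤ k) (i : Fin (n ^ k)) :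
    (((splitIndex n h).symm i).1 : ℕ) = i % n ^ m := by
  obtain ⟨p, rfl⟩ := (splitIndex n h).surjective i
  rw [Equiv.symm_apply_apply, splitIndex_val, Nat.add_mul_mod_self_left, Nat.mod_eq_of_lt p.1.2]

theorem splitIndex_symm_snd {m k : ℕ} (h : m ≤ k) (i : Fin (n ^ k)) :
    (((splitIndex n h).symm i).2 : ℕ) = i / n ^ m := by
  obtain ⟨p, rfl⟩ := (splitIndex n h).surjective i
  have hpos : 0 < n ^ m := lt_of_le_of_lt (Nat.zero_le _) p.1.2
  rw [Equiv.symm_apply_apply, splitIndex_val, Nat.add_mul_div_left _ _ hpos,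
    Nat.div_eq_of_lt p.1.2, Nat.zero_add]

theorem transition_apply (m k : ℕ) (h : m ≤ k) (A : Matrix (Fin (n ^ m)) (Fin (n ^ m)) R)
    (i j : Fin (n ^ k)) :
    transition n R m k h A i j =
      if (i : ℕ) / n ^ m = (j : ℕ) / n ^ m then
        A ((splitIndex n h).symm i).1 ((splitIndex n h).symm j).1 else 0 := by
  have : transition n R m k h A i j =
      Matrix.blockDiagonal (fun _ : Fin (n ^ (k - m)) => A)
        ((splitIndex n h).symm i) ((splitIndex n h).symm j) := rfl
  rw [this, Matrix.blockDiagonal_apply]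
  simp only [Fin.ext_iff, splitIndex_symm_snd]

instance directedSystem :
    DirectedSystem (fun k : ℕ => Matrix (Fin (n ^ k)) (Fin (n ^ k)) R)
      (fun m k h => transition n R m k h) where
  map_self k A := by
    ext i j
    have key (i : Fin (n ^ k)) : ((splitIndex n (le_refl k)).symm i).1 = i := by
      apply Fin.ext
      rw [splitIndex_symm_fst, Nat.mod_eq_of_lt i.2]
    rw [transition_apply, key, key, Nat.div_eq_of_lt i.2, Nat.div_eq_of_lt j.2, if_pos rfl]
  map_map c b a hab hbc A := by
    ext i j
    have key (i : Fin (n ^ c)) :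
        ((splitIndex n hab).symm ((splitIndex n hbc).symm i).1).1 =
          ((splitIndex n (hab.trans hbc)).symm i).1 := by
      apply Fin.ext
      rw [splitIndex_symm_fst, splitIndex_symm_fst, splitIndex_symm_fst,
        Nat.mod_mod_of_dvd _ (pow_dvd_pow n hab)]
    have hb : n ^ b = n ^ a * n ^ (b - a) := by rw [← pow_add, Nat.add_sub_cancel' hab]
    have hdiv (x y : ℕ) : x / n ^ a = y / n ^ a ↔
        x / n ^ b = y / n ^ b ∧ x % n ^ b / n ^ a = y % n ^ b / n ^ a := by
      rw [hb, ← Nat.div_div_eq_div_mul, ← Nat.div_div_eq_div_mul, Nat.mod_mul_right_div_self,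
        Nat.mod_mul_right_div_self]
      constructor
      · intro h
        rw [h]
        exact ⟨rfl, rfl⟩
      · rintro ⟨h1, h2⟩
        rw [← Nat.div_add_mod (x / n ^ a) (n ^ (b - a)), h1, h2, Nat.div_add_mod]
    simp only [transition_apply, splitIndex_symm_fst, key, hdiv (i : ℕ) (j : ℕ)]
    split_ifs <;> first | rfl | tauto

end MatricialClosure

/-- The `n`-matricial closure of the ring `R`: the direct limit of the rings `M_{n ^ k}(R)`,
`k = 0, 1, 2, …`, along the block diagonal embeddings. -/
def MatricialClosure (n : ℕ) (R : Type u) [Ring R] : Type u :=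
  DirectLimit (fun k : ℕ => Matrix (Fin (n ^ k)) (Fin (n ^ k)) R)
    (fun m k h => MatricialClosure.transition n R m k h)

namespace MatricialClosure

noncomputable instance instRing (n : ℕ) (R : Type u) [Ring R] : Ring (MatricialClosure n R) :=
  (inferInstance : Ring (DirectLimit (fun k : ℕ => Matrix (Fin (n ^ k)) (Fin (n ^ k)) R)
    (fun m k h => transition n R m k h)))

/-- The canonical ring homomorphism `M_{n ^ k}(R) → MC_n(R)` into the direct limit. -/
def of (n : ℕ) (R : Type u) [Ring R] (k : ℕ) :
    Matrix (Fin (n ^ k)) (Fin (n ^ k)) R →+* MatricialClosure n R where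
  toFun A := Quotient.mk (DirectLimit.setoid (fun m k h => transition n R m k h)) ⟨k, A⟩
  map_one' := (DirectLimit.one_def (f := fun m k h => transition n R m k h) k).symm
  map_mul' A B := (DirectLimit.mul_def (f := fun m k h => transition n R m k h) k A B).symm
  map_zero' := (DirectLimit.zero_def (f := fun m k h => transition n R m k h) k).symm
  map_add' A B := (DirectLimit.add_def (f := fun m k h => transition n R m k h) k A B).symm

theorem of_transition (n : ℕ) (R : Type u) [Ring R] (m k : ℕ) (h : m ≤ k)
    (A : Matrix (Fin (n ^ m)) (Fin (n ^ m)) R) :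
    of n R k (transition n R m k h A) = of n R m A :=
  Quotient.sound (s := DirectLimit.setoid (fun m k h => transition n R m k h))
    ⟨k, le_rfl, h, DirectedSystem.map_self (f := fun m k h => transition n R m k h) _⟩

theorem exists_of (n : ℕ) (R : Type u) [Ring R] (x : MatricialClosure n R) :
    ∃ (k : ℕ) (A : Matrix (Fin (n ^ k)) (Fin (n ^ k)) R), of n R k A = x := by
  obtain ⟨⟨k, A⟩, rfl⟩ := Quotient.exists_rep x
  exact ⟨k, A, rfl⟩

theorem transition_scalar (n : ℕ) (R : Type u) [Ring R] (k : ℕ) (r : R) :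
    transition n R 0 k (Nat.zero_le k) (Matrix.scalar _ r) = Matrix.scalar _ r := by
  ext i j
  have hs : Subsingleton (Fin (n ^ 0)) := by rw [pow_zero]; infer_instance
  rw [transition_apply, Subsingleton.elim ((splitIndex n (Nat.zero_le k)).symm i).1
    ((splitIndex n (Nat.zero_le k)).symm j).1]
  rw [Matrix.scalar_apply, Matrix.scalar_apply, Matrix.diagonal_apply_eq, Matrix.diagonal_apply,
    pow_zero, Nat.div_one, Nat.div_one]
  simp only [Fin.ext_iff]

/-- The `R`-algebra structure of `MC_n(R)` for commutative `R`, through the canonical map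
`R = M_{n ^ 0}(R) → MC_n(R)`. -/
noncomputable instance instAlgebra (n : ℕ) (R : Type u) [CommRing R] : Algebra R (MatricialClosure n R) :=
  ((of n R 0).comp (Matrix.scalar (Fin (n ^ 0)))).toAlgebra' (by
    intro r x
    obtain ⟨k, A, rfl⟩ := exists_of n R x
    rw [RingHom.comp_apply, ← of_transition n R 0 k (Nat.zero_le k), transition_scalar,
      ← map_mul, ← map_mul, (Matrix.scalar_commute r (fun _ => mul_comm _ _) A).eq])

end MatricialClosure

/-! Regularity and the center are settled inside a single `M_{n ^ k}(K)`, and matrix units of all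
levels span, so the dimension is countable. For `n ≥ 2` there are infinitely many orthogonal
idempotents `e k`, each generating the unit ideal, hence each nonzero on every simple `S`. If `S`
were injective, maps out of `⨁ R e_i` would extend to `R`, so the components `e i • x` could be
prescribed independently and `S` would have at least the dimension of `ℕ → K`, which is uncountable.
But `S` is a quotient of `R`, so its dimension is countable. See
`not_injective_of_orthogonalIdempotents`. -/

theorem Matrix.exists_eq_mul_mul_self {K : Type*} [Field K] {m : Type*} [Fintype m]
    [DecidableEq m] (A : Matrix m m K) : ∃ X : Matrix m m K, A = A * X * A := by
  -- A section of `A` over its range, extended linearly to the whole space, is a quasi-inverse.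
  obtain ⟨g, hg⟩ := (Matrix.toLin' A).rangeRestrict.exists_rightInverse_of_surjective
    (LinearMap.range_rangeRestrict _)
  obtain ⟨h, hh⟩ := LinearMap.exists_extend g
  refine ⟨LinearMap.toMatrix' h, Matrix.toLin'.injective ?_⟩
  rw [Matrix.toLin'_mul, Matrix.toLin'_mul, Matrix.toLin'_toMatrix']
  refine LinearMap.ext fun x => ?_
  have h1 := LinearMap.congr_fun hh ((Matrix.toLin' A).rangeRestrict x)
  have h2 := congrArg Subtype.val
    (LinearMap.congr_fun hg ((Matrix.toLin' A).rangeRestrict x))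
  simp only [LinearMap.comp_apply, Submodule.subtype_apply, LinearMap.id_apply,
    LinearMap.codRestrict_apply, LinearMap.rangeRestrict] at h1 h2 ⊢
  rw [h1, h2]

section OrthogonalIdempotents

variable {R : Type u} [Ring R] {e : ℕ → R}

/-- An injective module realizes arbitrary components along a sequence of orthogonal
idempotents. -/
theorem Module.Injective.exists_forall_smul_eq {S : Type u} [AddCommGroup S] [Module R S]
    (hS : Module.Injective R S) (he : OrthogonalIdempotents e) (v : ℕ → S) :
    ∃ x : S, ∀ i, e i • x = e i • v i := by
  let f : (Π₀ i : ℕ, Ideal.span {e i}) →ₗ[R] R :=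
    DFinsupp.lsum ℕ fun i => (Ideal.span {e i}).subtype
  let g : (Π₀ i : ℕ, Ideal.span {e i}) →ₗ[R] S :=
    DFinsupp.lsum ℕ fun i => LinearMap.toSpanSingleton R S (v i) ∘ₗ (Ideal.span {e i}).subtype
  -- Right multiplication by `e j` recovers the `j`-th component, so the sum of the left ideals `R
  -- e_i` is direct.
  have hf : ∀ x j, f x * e j = x j := by
    intro x j
    induction x using DFinsupp.induction with
    | h0 => simp
    | ha i b x _ _ ih =>
      rw [map_add, add_mul, ih, DFinsupp.add_apply, Submodule.coe_add]
      congr 1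
      obtain ⟨b, hb⟩ := b
      obtain ⟨r, rfl⟩ := Ideal.mem_span_singleton'.1 hb
      have hs : f (DFinsupp.single i ⟨r * e i, hb⟩) = r * e i := by simp [f]
      rw [hs, mul_assoc, he.mul_eq]
      split_ifs with h
      · subst h
        simp
      · rw [DFinsupp.single_eq_of_ne (Ne.symm h)]
        simp
  have hinj : Function.Injective f := by
    intro x y hxy
    ext j
    rw [← hf, ← hf, hxy]
  obtain ⟨h, hh⟩ := hS.out f hinj g
  -- The extension `h : R → S` satisfies `e i • h 1 = h (e i) = e i • v i`.
  refine ⟨h 1, fun i => ?_⟩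
  have := hh (DFinsupp.single i ⟨e i, Ideal.mem_span_singleton_self _⟩)
  simp only [f, g, DFinsupp.lsum_single, LinearMap.comp_apply, Submodule.subtype_apply,
    LinearMap.toSpanSingleton_apply] at this
  rw [← this, ← map_smul, smul_eq_mul, mul_one]

/-- Over an algebra of countable dimension, a simple module on which infinitely many orthogonal
idempotents act nontrivially is not injective. -/
theorem not_injective_of_orthogonalIdempotents {K : Type u} [Field K] [Algebra K R]
    (hR : Module.rank K R ≤ Cardinal.aleph0) (he : OrthogonalIdempotents e)
    {S : Type u} [AddCommGroup S] [Module R S] [IsSimpleModule R S]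
    (hne : ∀ i, ∃ v : S, e i • v ≠ 0) : ¬ Module.Injective R S := by
  intro hS
  choose v hv using hne
  let : Module K S := Module.compHom S (algebraMap K R)
  have : IsScalarTower K R S := IsScalarTower.of_algebraMap_smul fun _ _ => rfl
  have : SMulCommClass R K S := IsScalarTower.to_smulCommClass'
  have hSrank : Module.rank K S ≤ Cardinal.aleph0 := by
    refine le_trans ?_ hR
    exact LinearMap.rank_le_of_surjective ((LinearMap.toSpanSingleton R S (v 0)).restrictScalars K)
      (IsSimpleModule.toSpanSingleton_surjective R fun h => hv 0 (by rw [h, smul_zero]))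
  let Φ : S →ₗ[K] (ℕ → S) := LinearMap.pi fun i => Module.toModuleEnd K S (e i)
  let Ψ : (ℕ → K) →ₗ[K] (ℕ → S) :=
    LinearMap.pi fun i => LinearMap.toSpanSingleton K S (e i • v i) ∘ₗ LinearMap.proj i
  have hΨ : Function.Injective Ψ := by
    intro a b hab
    funext i
    exact smul_left_injective K (hv i) (congrFun hab i)
  have hle : LinearMap.range Ψ ≤ LinearMap.range Φ := by
    rintro _ ⟨a, rfl⟩
    obtain ⟨x, hx⟩ := hS.exists_forall_smul_eq he fun i => a i • v i
    refine ⟨x, funext fun i => (hx i).trans ?_⟩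
    exact smul_comm (e i) (a i) (v i)
  have h1 : Module.rank K (ℕ → K) ≤ Cardinal.aleph0 := by
    rw [← rank_range_of_injective Ψ hΨ]
    exact (Submodule.rank_mono hle).trans ((rank_range_le Φ).trans hSrank)
  -- By Erdős–Kaplansky the dimension of `ℕ → K` is its cardinality, at least `2 ^ ℵ₀`.
  rw [rank_fun_infinite, Cardinal.mk_arrow, Cardinal.mk_nat] at h1
  have h2 : (2 : Cardinal) ≤ Cardinal.mk K := Cardinal.two_le_iff.2 (exists_pair_ne K)
  exact (Cardinal.cantor _).not_ge ((Cardinal.power_le_power_right h2).trans (by simpa using h1))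

theorem OrthogonalIdempotents.linearIndependent {K : Type*} [Field K] [Algebra K R]
    (he : OrthogonalIdempotents e) (hne : ∀ i, e i ≠ 0) : LinearIndependent K e := by
  rw [linearIndependent_iff']
  intro s c hc i hi
  have h1 := congrArg (· * e i) hc
  simp only [Finset.sum_mul, smul_mul_assoc, he.mul_eq, zero_mul, smul_ite, smul_zero,
    Finset.sum_ite_eq', if_pos hi] at h1
  exact (smul_eq_zero.1 h1).resolve_right (hne i)

end OrthogonalIdempotents

/-- The annihilator of a module is a two-sided ideal; here it contains `e`, hence `1`. -/
theorem eq_zero_of_sum_mul_mul_eq_one {R : Type*} [Ring R] {ι : Type*} [Fintype ι] {a b : ι → R}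
    {e : R} (h : ∑ j, a j * (e * b j) = 1) {S : Type*} [AddCommGroup S] [Module R S]
    (he : ∀ s : S, e • s = 0) (s : S) : s = 0 := by
  rw [← one_smul R s, ← h, Finset.sum_smul]
  refine Finset.sum_eq_zero fun j _ => ?_
  rw [mul_smul, mul_smul, he, smul_zero]

theorem exists_isSimpleModule (R : Type u) [Ring R] [Nontrivial R] :
    ∃ (S : Type u) (_ : AddCommGroup S) (_ : Module R S), IsSimpleModule R S := by
  obtain ⟨I, hI⟩ := Ideal.exists_maximal R
  exact ⟨R ⧸ I, inferInstance, inferInstance, isSimpleModule_iff_isCoatom.2 hI.out⟩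

namespace MatricialClosure

theorem isVonNeumannRegularRing (n : ℕ) (K : Type u) [Field K] :
    IsVonNeumannRegularRing (MatricialClosure n K) := by
  intro a
  obtain ⟨k, A, rfl⟩ := exists_of n K a
  obtain ⟨X, hX⟩ := A.exists_eq_mul_mul_self
  exact ⟨of n K k X, by rw [← map_mul, ← map_mul, ← hX]⟩

theorem transition_injective {n : ℕ} (hn : 1 ≤ n) (R : Type u) [Ring R] {m k : ℕ} (h : m ≤ k) :
    Function.Injective (transition n R m k h) := by
  -- At least one diagonal block exists, from which the matrix can be read off.
  have : Nonempty (Fin (n ^ (k - m))) := ⟨⟨0, Nat.pow_pos hn⟩⟩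
  intro A B hAB
  have h1 := (Matrix.reindexRingEquiv R (splitIndex n h)).injective
    (a₁ := Matrix.blockDiagonal fun _ => A) (a₂ := Matrix.blockDiagonal fun _ => B) hAB
  exact Function.const_injective (Matrix.blockDiagonal_injective h1)

theorem of_injective {n : ℕ} (hn : 1 ≤ n) (R : Type u) [Ring R] (k : ℕ) :
    Function.Injective (of n R k) := by
  intro A B hAB
  obtain ⟨l, h1, _, h3⟩ := Quotient.exact
    (s := DirectLimit.setoid (fun m k h => transition n R m k h)) hAB
  exact transition_injective hn R h1 h3

theorem algebraMap_eq_of_scalar (n : ℕ) (R : Type u) [CommRing R] (k : ℕ) (r : R) :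
    algebraMap R (MatricialClosure n R) r = of n R k (Matrix.scalar _ r) := by
  rw [← transition_scalar, of_transition]
  rfl

theorem of_smul (n : ℕ) (R : Type u) [CommRing R] (k : ℕ) (r : R)
    (A : Matrix (Fin (n ^ k)) (Fin (n ^ k)) R) : of n R k (r • A) = r • of n R k A := by
  rw [Algebra.smul_def r (of n R k A), algebraMap_eq_of_scalar n R k, ← map_mul,
    Matrix.scalar_apply, Matrix.smul_eq_diagonal_mul]

/-- A central element commutes with the matrix units of its own level; injectivity of `of` turns
this into commutation of matrices, which forces a scalar. -/
theorem center_eq_bot {n : ℕ} (hn : 1 ≤ n) (R : Type u) [CommRing R] :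
    Subalgebra.center R (MatricialClosure n R) = ⊥ := by
  refine le_antisymm (fun x hx => ?_) bot_le
  obtain ⟨k, A, rfl⟩ := exists_of n R x
  rw [Subalgebra.mem_center_iff] at hx
  obtain ⟨r, rfl⟩ := Matrix.mem_range_scalar_of_commute_single (M := A) fun i j _ =>
    of_injective hn R k (by simpa only [map_mul] using hx (of n R k (Matrix.single i j 1)))
  exact Algebra.mem_bot.2 ⟨r, algebraMap_eq_of_scalar n R k r⟩

theorem rank_le_aleph0 (n : ℕ) (K : Type u) [Field K] :
    Module.rank K (MatricialClosure n K) ≤ Cardinal.aleph0 := by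
  let b : (Σ k : ℕ, Fin (n ^ k) × Fin (n ^ k)) → MatricialClosure n K :=
    fun p => of n K p.1 (Matrix.single p.2.1 p.2.2 1)
  have hb : Submodule.span K (Set.range b) = ⊤ := by
    refine eq_top_iff.2 fun x _ => ?_
    obtain ⟨k, A, rfl⟩ := exists_of n K x
    rw [Matrix.matrix_eq_sum_single A, map_sum]
    refine Submodule.sum_mem _ fun i _ => ?_
    rw [map_sum]
    refine Submodule.sum_mem _ fun j _ => ?_
    rw [← mul_one (A i j), ← smul_eq_mul, ← Matrix.smul_single, of_smul]
    exact Submodule.smul_mem _ _ (Submodule.subset_span ⟨⟨k, i, j⟩, rfl⟩)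
  rw [← rank_top, ← hb]
  exact (rank_span_le _).trans (Cardinal.mk_le_aleph0_iff.2 (Set.countable_range b).to_subtype)

/-- The image in `MC_n(R)` of the diagonal matrix unit of `M_{n ^ (k + 1)}(R)` at the
index `n ^ k`. -/
noncomputable def idempotent {n : ℕ} (hn : 2 ≤ n) (R : Type u) [Ring R] (k : ℕ) :
    MatricialClosure n R :=
  of n R (k + 1) (Matrix.single ⟨n ^ k, Nat.pow_lt_pow_right hn k.lt_succ_self⟩
    ⟨n ^ k, Nat.pow_lt_pow_right hn k.lt_succ_self⟩ 1)

theorem transition_single_eq_diagonal {n : ℕ} (R : Type u) [Ring R] {m k : ℕ} (h : m ≤ k)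
    (a : Fin (n ^ m)) :
    transition n R m k h (Matrix.single a a 1) =
      Matrix.diagonal fun i : Fin (n ^ k) => if (i : ℕ) % n ^ m = a then 1 else 0 := by
  ext i j
  rw [transition_apply, Matrix.diagonal_apply, Matrix.single_apply]
  simp only [Fin.ext_iff, splitIndex_symm_fst]
  by_cases hij : (i : ℕ) = j
  · simp [hij, eq_comm]
  · by_cases hd : (i : ℕ) / n ^ m = j / n ^ m
    · have : ¬ ((a : ℕ) = i % n ^ m ∧ (a : ℕ) = j % n ^ m) := fun hm => hij (by
        rw [← Nat.div_add_mod (i : ℕ) (n ^ m), ← Nat.div_add_mod (j : ℕ) (n ^ m), hd,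
          ← hm.1, ← hm.2])
      simp [hij, this]
    · simp [hij, hd]

/-- At higher levels the `k`-th idempotent is diagonal, supported on the `i` whose lowest nonzero
base-`n` digit is a `1` in position `k`. These supports are disjoint for distinct `k`. -/
theorem orthogonalIdempotents_idempotent {n : ℕ} (hn : 2 ≤ n) (R : Type u) [Ring R] :
    OrthogonalIdempotents (idempotent hn R) := by
  have key {m k : ℕ} (h : m < k) (i : ℕ) (h1 : i % n ^ (m + 1) = n ^ m)
      (h2 : i % n ^ (k + 1) = n ^ k) : False := by
    have h3 : i % n ^ (k + 1) % n ^ (m + 1) = n ^ m := by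
      rwa [Nat.mod_mod_of_dvd _ (pow_dvd_pow n (by omega))]
    rw [h2, Nat.mod_eq_zero_of_dvd (pow_dvd_pow n h)] at h3
    exact (Nat.pow_pos (by omega : 0 < n)).ne h3
  refine ⟨fun k => ?_, fun m k hmk => ?_⟩
  · rw [IsIdempotentElem, idempotent, ← map_mul, Matrix.single_mul_single_same, mul_one]
  · dsimp only [idempotent]
    rw [← of_transition n R (m + 1) (max m k + 1) (by omega),
      ← of_transition n R (k + 1) (max m k + 1) (by omega), ← map_mul,
      transition_single_eq_diagonal, transition_single_eq_diagonal, Matrix.diagonal_mul_diagonal]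
    refine (congrArg _ ?_).trans (of n R (max m k + 1)).map_zero
    rw [Matrix.diagonal_eq_zero]
    funext i
    dsimp only [Pi.zero_apply]
    split_ifs with h1 h2 <;> simp only [mul_zero, mul_one]
    rcases lt_or_gt_of_ne hmk with h | h
    · exact (key h _ h1 h2).elim
    · exact (key h _ h2 h1).elim

theorem exists_idempotent_smul_ne_zero {n : ℕ} (hn : 2 ≤ n) (R : Type u) [Ring R]
    {S : Type*} [AddCommGroup S] [Module (MatricialClosure n R) S] [Nontrivial S] (k : ℕ) :
    ∃ v : S, idempotent hn R k • v ≠ 0 := by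
  by_contra! h
  obtain ⟨s, hs⟩ := exists_ne (0 : S)
  apply hs
  set a : Fin (n ^ (k + 1)) := ⟨n ^ k, Nat.pow_lt_pow_right hn k.lt_succ_self⟩ with ha
  -- Each `E_jj` equals `E_ja * E_aa * E_aj`, and the `E_jj` sum to `1`.
  have h1 : (1 : MatricialClosure n R) = ∑ j, of n R (k + 1) (Matrix.single j a 1) *
      (idempotent hn R k * of n R (k + 1) (Matrix.single a j 1)) := by
    dsimp only [idempotent]
    simp only [← ha, ← map_mul, Matrix.single_mul_single_same, mul_one, ← map_sum,
      Matrix.sum_single_one, map_one]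
  exact eq_zero_of_sum_mul_mul_eq_one h1.symm h s

theorem nontrivial {n : ℕ} (hn : 1 ≤ n) (R : Type u) [Ring R] [Nontrivial R] :
    Nontrivial (MatricialClosure n R) := by
  have : Nonempty (Fin (n ^ 0)) := ⟨⟨0, Nat.pow_pos hn⟩⟩
  exact (of_injective hn R 0).nontrivial

theorem idempotent_ne_zero {n : ℕ} (hn : 2 ≤ n) (R : Type u) [Ring R] [Nontrivial R] (k : ℕ) :
    idempotent hn R k ≠ 0 := by
  rw [idempotent, Ne, map_eq_zero_iff _ (of_injective (by omega) R (k + 1))]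
  exact fun h => one_ne_zero ((Matrix.single_apply_same _ _ _).symm.trans
    (congrFun (congrFun h _) _))

theorem aleph0_le_rank {n : ℕ} (hn : 2 ≤ n) (K : Type u) [Field K] :
    Cardinal.aleph0 ≤ Module.rank K (MatricialClosure n K) := by
  have hli := (orthogonalIdempotents_idempotent hn K).linearIndependent (K := K)
    (idempotent_ne_zero hn K)
  simpa using hli.cardinal_lift_le_rank

theorem not_injective_of_isSimpleModule {n : ℕ} (hn : 2 ≤ n) (K : Type u) [Field K]
    (S : Type u) [AddCommGroup S] [Module (MatricialClosure n K) S]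
    (hS : IsSimpleModule (MatricialClosure n K) S) :
    ¬ Module.Injective (MatricialClosure n K) S :=
  have := IsSimpleModule.nontrivial (MatricialClosure n K) S
  not_injective_of_orthogonalIdempotents (rank_le_aleph0 n K)
    (orthogonalIdempotents_idempotent hn K) (exists_idempotent_smul_ne_zero hn K)

end MatricialClosure

theorem mainTheorem11 (n : ℕ) (hn : 1 ≤ n) (K : Type u) [Field K] :
    IsVonNeumannRegularRing (MatricialClosure n K) ∧
    Subalgebra.center K (MatricialClosure n K) = ⊥ ∧
    Module.rank K (MatricialClosure n K) ≤ Cardinal.aleph0 ∧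
    (2 ≤ n →
      Module.rank K (MatricialClosure n K) = Cardinal.aleph0 ∧
      (∃ (S : Type u) (_ : AddCommGroup S) (_ : Module (MatricialClosure n K) S),
        IsSimpleModule (MatricialClosure n K) S ∧
        ¬ Module.Injective (MatricialClosure n K) S) ∧
      (∀ (S : Type u) [AddCommGroup S] [Module (MatricialClosure n K) S],
        IsSimpleModule (MatricialClosure n K) S →
        ¬ Module.Injective (MatricialClosure n K) S) ∧
      ¬ IsLeftVRing (MatricialClosure n K)) := by
  refine ⟨MatricialClosure.isVonNeumannRegularRing n K, MatricialClosure.center_eq_bot hn K,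
    MatricialClosure.rank_le_aleph0 n K, fun h2 => ?_⟩
  have := MatricialClosure.nontrivial hn K
  obtain ⟨S, _, _, hS⟩ := exists_isSimpleModule (MatricialClosure n K)
  have hS' := MatricialClosure.not_injective_of_isSimpleModule h2 K S hS
  exact ⟨le_antisymm (MatricialClosure.rank_le_aleph0 n K) (MatricialClosure.aleph0_le_rank h2 K),
    ⟨_, _, _, hS, hS'⟩, MatricialClosure.not_injective_of_isSimpleModule h2 K,
    fun h => hS' (h _ hS)⟩
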